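/- Let $G$ be a group and $k\ge 1$ an integer. A set $A\subseteq G$ is called $k$-stable if there do not exist $a_1,\dots,a_k,b_1,\dots,b_k\in G$ such that, for all $1\le i,j\le k$, $a_ib_j\in A$ if and only if $i\le j$. For every integer $k\ge 1$ there is a constant $C_k>0$, depending only on $k$, such that the following holds. Let $G$ be any group, let $c$ be a real number, and let $A\subseteq G$ be a finite nonempty $k$-stable set with $|AA^{-1}A|\le c|A|$. Then there is a subgroup $H\le G$ such that $H\subseteq A^{-1}A$ and $A$ is covered by at most $$C_k\, c^{\,k^{2^{2^{2k}}}}$$ left cosets of $H$. -/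

import Mathlib

open scoped Pointwise

/-- A subset `A` of a group `G` is `k`-stable if there do not exist `a₁, …, aₖ, b₁, …, bₖ` in `G`
such that `aᵢ * bⱼ ∈ A` if and only if `i ≤ j`. -/
def IsStableSet {G : Type*} [Group G] (k : ℕ) (A : Set G) : Prop :=
  ¬ ∃ a b : Fin k → G, ∀ i j : Fin k, a i * b j ∈ A ↔ i ≤ j

/-! The number of `a ∈ A` with `a * x ∉ A` is a length function of `x`: it is subadditive and
invariant under inversion. If no length lies in `(t/2, t]`, the elements of length at most `t` form
a subgroup `H`; for `t < |A|` it lies in `A⁻¹A`.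

Such a gap exists because of stability. If each of many rapidly decreasing scales had a witness `x
i`, averaging would place translates of their exit sets in a long half graph
(`exists_halfGraph_of_scales`). By Ramsey this gives a half graph for `A` itself
(`not_ladder_diff`).

Stability also makes `H` large. If `H` is small compared with `F ⊆ A`, most pairs in `F` differ by
an element of large length, so double counting finds a `z` for which `z * b ∈ A` splits `F` into two
sizeable parts (`exists_balanced_split`). Iteration builds a deep binary tree, whereas a deep tree
contains a half graph (`exists_ladder`). Ruzsa covering then bounds the number of cosets. -/

/-- `HasSplitTree R d Z F`: there is a complete binary tree of depth `d` with nodes in `Z` whose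
branches are all realised by elements of `F`. -/
def HasSplitTree {α β : Type*} (R : α → β → Prop) : ℕ → Set α → Set β → Prop
  | 0, _, F => F.Nonempty
  | d + 1, Z, F => ∃ z ∈ Z, HasSplitTree R d Z {b ∈ F | R z b} ∧
      HasSplitTree R d Z {b ∈ F | ¬ R z b}

/-! ### Binary trees and half graphs -/

namespace HasSplitTree

variable {α β : Type*} {R : α → β → Prop}

theorem mono {d : ℕ} {Z : Set α} {F F' : Set β} (hF : F ⊆ F')
    (h : HasSplitTree R d Z F) : HasSplitTree R d Z F' := by
  induction d generalizing F F' with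
  | zero => exact Set.Nonempty.mono hF h
  | succ d ih =>
    obtain ⟨z, hz, h1, h2⟩ := h
    exact ⟨z, hz, ih (fun b hb => ⟨hF hb.1, hb.2⟩) h1, ih (fun b hb => ⟨hF hb.1, hb.2⟩) h2⟩

theorem nonempty {d : ℕ} {Z : Set α} {F : Set β} (h : HasSplitTree R d Z F) : F.Nonempty := by
  induction d generalizing F with
  | zero => exact h
  | succ d ih =>
    obtain ⟨z, hz, h1, h2⟩ := h
    exact (ih h1).mono fun b hb => hb.1

/-- Colouring the nodes of a tree with two colours produces a large monochromatic subtree. -/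
theorem of_union {n p q : ℕ} (hn : n = p + q) {Z₁ Z₂ : Set α} {F : Set β}
    (h : HasSplitTree R n (Z₁ ∪ Z₂) F) : HasSplitTree R p Z₁ F ∨ HasSplitTree R q Z₂ F := by
  induction n generalizing p q F with
  | zero =>
    obtain rfl : p = 0 := by omega
    exact Or.inl h
  | succ n ih =>
    rcases p with _ | p
    · exact Or.inl h.nonempty
    rcases q with _ | q
    · exact Or.inr h.nonempty
    obtain ⟨z, hz, h1, h2⟩ := h
    -- If both subtrees yield a tree in the root's colour, the root joins them; otherwise one
    -- subtree already has a full tree in the other colour.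
    rcases hz with hz | hz
    · rcases ih (p := p) (q := q + 1) (by omega) h1 with h1 | h1
      · rcases ih (p := p) (q := q + 1) (by omega) h2 with h2 | h2
        · exact Or.inl ⟨z, hz, h1, h2⟩
        · exact Or.inr (h2.mono fun b hb => hb.1)
      · exact Or.inr (h1.mono fun b hb => hb.1)
    · rcases ih (p := p + 1) (q := q) (by omega) h1 with h1 | h1
      · exact Or.inl (h1.mono fun b hb => hb.1)
      · rcases ih (p := p + 1) (q := q) (by omega) h2 with h2 | h2
        · exact Or.inl (h2.mono fun b hb => hb.1)
        · exact Or.inr ⟨z, hz, h1, h2⟩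

/-- A deep split tree contains a long half graph of one of the two orientations. -/
theorem exists_ladder (p q : ℕ) : ∀ (D : ℕ) (Z : Set α) (F : Set β), 2 ^ (p + q + 1) ≤ D + 2 →
    HasSplitTree R D Z F →
    (∃ (a : Fin p → α) (b : Fin p → β), (∀ i, a i ∈ Z) ∧ (∀ i, b i ∈ F) ∧
      ∀ i j, R (a i) (b j) ↔ j ≤ i) ∨
    (∃ (a : Fin q → α) (b : Fin q → β), (∀ i, a i ∈ Z) ∧ (∀ i, b i ∈ F) ∧
      ∀ i j, R (a i) (b j) ↔ i < j) := by
  induction p generalizing q with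
  | zero =>
    intro D Z F _ _
    exact Or.inl ⟨Fin.elim0, Fin.elim0, fun i => i.elim0, fun i => i.elim0, fun i => i.elim0⟩
  | succ p ihp =>
    induction q with
    | zero =>
      intro D Z F _ _
      exact Or.inr ⟨Fin.elim0, Fin.elim0, fun i => i.elim0, fun i => i.elim0, fun i => i.elim0⟩
    | succ q ihq =>
      intro D Z F hD h
      obtain ⟨f, hf⟩ := h.nonempty
      have e1 : 2 ^ (p + 1 + (q + 1) + 1) = 2 * 2 ^ (p + q + 2) := by ring
      have e2 : p + (q + 1) + 1 = p + q + 2 := by ring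
      have e3 : p + 1 + q + 1 = p + q + 2 := by ring
      have e4 : 2 ^ (p + q + 2) = 4 * 2 ^ (p + q) := by ring
      have e5 : 0 < 2 ^ (p + q) := by positivity
      -- The depth suffices for a monochromatic subtree of depth `e + 1` or `e' + 1` with `e ≤ e'`.
      -- One level is spent on its root `z`, leaving exactly what induction needs.
      obtain ⟨e, he⟩ : ∃ e, 2 ^ (p + q + 2) = e + 2 := ⟨2 ^ (p + q + 2) - 2, by omega⟩
      obtain ⟨e', he'⟩ : ∃ e', D = (e + 1) + (e' + 1) := ⟨D - e - 2, by omega⟩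
      -- Nodes are coloured by their relation to one fixed `f`. The pair `(z, f)` can then be
      -- prepended to a ladder found on the side of `z` that disagrees with `f`.
      have hZ : Z = {z ∈ Z | R z f} ∪ {z ∈ Z | ¬ R z f} := by
        ext z; by_cases hz : R z f <;> simp [hz]
      rw [hZ] at h
      rcases h.of_union he' with ⟨z, hz, h1, h2⟩ | ⟨z, hz, h1, h2⟩
      · rcases ihp (q + 1) e _ _ (by rw [e2]; omega) h2 with ⟨a, b, ha, hb, hab⟩ | ⟨a, b, ha, hb, hab⟩
        · refine Or.inl ⟨Fin.cons z a, Fin.cons f b, ?_, ?_, ?_⟩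
          · exact Fin.cases hz.1 fun i => (ha i).1
          · exact Fin.cases hf fun i => (hb i).1
          · refine Fin.cases (Fin.cases ?_ fun j => ?_) fun i => Fin.cases ?_ fun j => ?_
            · simpa using hz.2
            · simpa using (hb j).2
            · simpa using (ha i).2
            · simpa using hab i j
        · exact Or.inr ⟨a, b, fun i => (ha i).1, fun i => (hb i).1, hab⟩
      · rcases ihq e' _ _ (by rw [e3]; omega) h1 with ⟨a, b, ha, hb, hab⟩ | ⟨a, b, ha, hb, hab⟩
        · exact Or.inl ⟨a, b, fun i => (ha i).1, fun i => (hb i).1, hab⟩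
        · refine Or.inr ⟨Fin.cons z a, Fin.cons f b, ?_, ?_, ?_⟩
          · exact Fin.cases hz.1 fun i => (ha i).1
          · exact Fin.cases hf fun i => (hb i).1
          · refine Fin.cases (Fin.cases ?_ fun j => ?_) fun i => Fin.cases ?_ fun j => ?_
            · simpa using hz.2
            · simpa using (hb j).2
            · simpa using (ha i).2
            · simpa using hab i j

end HasSplitTree

/-! ### Ramsey's theorem -/

/-- Ramsey's theorem for pairs and two colours. -/
theorem Finset.exists_homogeneous (c : ℕ → ℕ → Prop) (p q : ℕ) : ∀ s : Finset ℕ,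
    2 ^ (p + q) ≤ s.card →
    (∃ t ⊆ s, t.card = p ∧ ∀ i ∈ t, ∀ j ∈ t, i < j → c i j) ∨
    (∃ t ⊆ s, t.card = q ∧ ∀ i ∈ t, ∀ j ∈ t, i < j → ¬ c i j) := by
  classical
  induction p generalizing q with
  | zero => intro s _; exact Or.inl ⟨∅, by simp⟩
  | succ p ihp =>
    induction q with
    | zero => intro s _; exact Or.inr ⟨∅, by simp⟩
    | succ q ihq =>
      intro s hs
      have hpos : 0 < s.card := lt_of_lt_of_le (by positivity) hs
      have hne : s.Nonempty := Finset.card_pos.1 hpos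
      set m := s.min' hne
      have hm : m ∈ s := s.min'_mem hne
      have hlt : ∀ i ∈ s.erase m, m < i := fun i hi =>
        lt_of_le_of_ne (s.min'_le i (Finset.mem_of_mem_erase hi)) (Finset.ne_of_mem_erase hi).symm
      have hcard : ((s.erase m).filter (c m)).card + ((s.erase m).filter fun i => ¬ c m i).card =
          (s.erase m).card := by
        convert Finset.card_filter_add_card_filter_not (s := s.erase m) (c m)
      have he := Finset.card_erase_of_mem hm
      have e1 : 2 ^ (p + 1 + (q + 1)) = 2 * 2 ^ (p + q + 1) := by ring
      have e2 : p + (q + 1) = p + q + 1 := by ring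
      have e3 : p + 1 + q = p + q + 1 := by ring
      have key : ∀ (d : ℕ → ℕ → Prop) (t : Finset ℕ) (r : ℕ), (∀ i ∈ t, i ∈ s.erase m ∧ d m i) →
          t.card = r → (∀ i ∈ t, ∀ j ∈ t, i < j → d i j) →
          ∃ t ⊆ s, t.card = r + 1 ∧ ∀ i ∈ t, ∀ j ∈ t, i < j → d i j := by
        intro d t r ht htc hd
        have hmt : ∀ i ∈ t, m < i ∧ d m i := fun i hi =>
          ⟨hlt i (ht i hi).1, (ht i hi).2⟩
        refine ⟨insert m t, ?_, ?_, ?_⟩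
        · exact Finset.insert_subset hm fun i hi =>
            Finset.mem_of_mem_erase (ht i hi).1
        · rw [Finset.card_insert_of_notMem (fun h => lt_irrefl _ (hmt m h).1), htc]
        · intro i hi j hj hij
          rcases Finset.mem_insert.1 hi with rfl | hi <;> rcases Finset.mem_insert.1 hj with rfl | hj
          · exact absurd hij (lt_irrefl _)
          · exact (hmt j hj).2
          · exact absurd hij (hmt i hi).1.not_gt
          · exact hd i hi j hj hij
      by_cases hc : 2 ^ (p + q + 1) ≤ ((s.erase m).filter (c m)).card
      · rcases ihp (q + 1) _ (by rwa [e2]) with ⟨t, ht, htc, hd⟩ | ⟨t, ht, htc, hd⟩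
        · exact Or.inl (key c t p (fun i hi => Finset.mem_filter.1 (ht hi)) htc hd)
        · exact Or.inr ⟨t, ht.trans ((Finset.filter_subset _ _).trans (Finset.erase_subset _ _)),
            htc, hd⟩
      · rcases ihq ((s.erase m).filter fun i => ¬ c m i) (by rw [e3]; omega) with
          ⟨t, ht, htc, hd⟩ | ⟨t, ht, htc, hd⟩
        · exact Or.inl ⟨t, ht.trans ((Finset.filter_subset _ _).trans (Finset.erase_subset _ _)),
            htc, hd⟩
        · exact Or.inr
            (key (fun i j => ¬ c i j) t q (fun i hi => Finset.mem_filter.1 (ht hi)) htc hd)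

/-! ### Configurations excluded by stability -/

namespace IsStableSet

variable {G : Type*} [Group G] {k : ℕ} {A : Set G}

theorem not_ladder_ge (hA : IsStableSet k A) (a b : Fin k → G) :
    ¬ ∀ i j, a i * b j ∈ A ↔ j ≤ i := fun h =>
  hA ⟨a ∘ Fin.rev, b ∘ Fin.rev, fun i j => by simpa using h i.rev j.rev⟩

/-- Dropping the last `a` and the first `b` turns `<` into `≤`, hence the length `k + 1`. -/
theorem not_ladder_lt (hA : IsStableSet k A) (a b : Fin (k + 1) → G) :
    ¬ ∀ i j, a i * b j ∈ A ↔ i < j := fun h =>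
  hA ⟨a ∘ Fin.castSucc, b ∘ Fin.succ, fun i j => by
    simpa [Fin.castSucc_lt_succ_iff] using h i.castSucc j.succ⟩

theorem not_hasSplitTree (hA : IsStableSet k A) {D : ℕ} (hD : 2 ^ (2 * k + 2) ≤ D + 2)
    (Z F : Set G) : ¬ HasSplitTree (fun z b => z * b ∈ A) D Z F := by
  intro h
  rcases h.exists_ladder k (k + 1) D Z F (by convert hD using 2; ring) with
    ⟨a, b, _, _, hab⟩ | ⟨a, b, _, _, hab⟩
  · exact hA.not_ladder_ge a b hab
  · exact hA.not_ladder_lt a b hab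

/-- The relation `z * g ∈ A ∧ z * g * x ∉ A` has no long half graphs. -/
theorem not_ladder_diff (hA : IsStableSet k A) {M : ℕ} (hM : 2 ^ (2 * k + 1) ≤ M)
    (z g x : ℕ → G) :
    ¬ ∀ i < M, ∀ j < M, (z j * g i ∈ A ∧ z j * g i * x i ∉ A) ↔ i ≤ j := by
  intro h
  -- For `j < i` the conjunction fails. If its first half fails throughout, the products `z j * g i`
  -- form a half graph; if the first half always holds, then `z j * g i * x i ∈ A` for `j < i`, and
  -- these products form one of the opposite orientation.
  rcases Finset.exists_homogeneous (fun j i => z j * g i ∉ A) k (k + 1) (Finset.range M)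
    (by rw [Finset.card_range]; convert hM using 2; ring) with ⟨t, ht, htc, hc⟩ | ⟨t, ht, htc, hc⟩
  · have hlt : ∀ i, t.orderEmbOfFin htc i < M := fun i =>
      Finset.mem_range.1 (ht (t.orderEmbOfFin_mem htc i))
    refine hA.not_ladder_ge (z ∘ t.orderEmbOfFin htc) (g ∘ t.orderEmbOfFin htc) fun j i => ?_
    by_cases hij : i ≤ j
    · exact iff_of_true ((h _ (hlt i) _ (hlt j)).2 ((t.orderEmbOfFin htc).monotone hij)).1 hij
    · exact iff_of_false (hc _ (t.orderEmbOfFin_mem htc j) _ (t.orderEmbOfFin_mem htc i)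
        ((t.orderEmbOfFin htc).strictMono (not_le.1 hij))) hij
  · have hlt : ∀ i, t.orderEmbOfFin htc i < M := fun i =>
      Finset.mem_range.1 (ht (t.orderEmbOfFin_mem htc i))
    refine hA.not_ladder_lt (z ∘ t.orderEmbOfFin htc)
      (fun i => g (t.orderEmbOfFin htc i) * x (t.orderEmbOfFin htc i)) fun j i => ?_
    rw [← mul_assoc]
    by_cases hij : i ≤ j
    · exact iff_of_false ((h _ (hlt i) _ (hlt j)).2 ((t.orderEmbOfFin htc).monotone hij)).2
        hij.not_gt
    · refine iff_of_true ?_ (not_le.1 hij)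
      have hlt' := (t.orderEmbOfFin htc).strictMono (not_le.1 hij)
      have h1 := not_not.1 (hc _ (t.orderEmbOfFin_mem htc j) _ (t.orderEmbOfFin_mem htc i) hlt')
      by_contra h2
      exact hlt'.not_ge ((h _ (hlt i) _ (hlt j)).1 ⟨h1, h2⟩)

end IsStableSet

/-! ### Exit sets as a length function -/

namespace Finset

variable {G : Type*} [Group G] [DecidableEq G]

/-- The elements of `A` that leave `A` under right multiplication by `x`. -/
def exitSet (A : Finset G) (x : G) : Finset G := A.filter fun a => a * x ∉ A

theorem mem_exitSet {A : Finset G} {x a : G} : a ∈ A.exitSet x ↔ a ∈ A ∧ a * x ∉ A :=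
  Finset.mem_filter

theorem exitSet_subset (A : Finset G) (x : G) : A.exitSet x ⊆ A := Finset.filter_subset _ _

theorem exitSet_one (A : Finset G) : A.exitSet 1 = ∅ := by
  ext a; simp [mem_exitSet]

/-- An element leaving `A` under `x * y` either leaves under `x`, or is moved by `x` into the exit
set of `y`. -/
theorem card_exitSet_mul_le (A : Finset G) (x y : G) :
    (A.exitSet (x * y)).card ≤ (A.exitSet x).card + (A.exitSet y).card := by
  have hsub : A.exitSet (x * y) ⊆ A.exitSet x ∪ (A.exitSet y).image (· * x⁻¹) := by
    intro a ha
    rw [mem_exitSet] at ha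
    rw [mem_union, mem_image]
    by_cases h : a * x ∈ A
    · exact Or.inr ⟨a * x, mem_exitSet.2 ⟨h, by rw [mul_assoc]; exact ha.2⟩, by group⟩
    · exact Or.inl (mem_exitSet.2 ⟨ha.1, h⟩)
  exact (card_le_card hsub).trans ((card_union_le _ _).trans
    (Nat.add_le_add_left card_image_le _))

/-- Multiplication by `x` matches the elements that stay in `A` under `x` with those that stay under
`x⁻¹`; finiteness then compares the complements. -/
theorem card_exitSet_inv (A : Finset G) (x : G) :
    (A.exitSet x⁻¹).card = (A.exitSet x).card := by
  have h1 := card_filter_add_card_filter_not (s := A) (fun a => a * x ∈ A)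
  have h2 := card_filter_add_card_filter_not (s := A) (fun a => a * x⁻¹ ∈ A)
  have h3 : (A.filter fun a => a * x ∈ A).card = (A.filter fun a => a * x⁻¹ ∈ A).card := by
    refine card_bij' (fun a _ => a * x) (fun a _ => a * x⁻¹) ?_ ?_ ?_ ?_ <;>
      simp +contextual [mem_filter]
  unfold exitSet
  omega

/-- If no translate of `A` lies at distance between `t / 2` and `t`, those at distance at most `t`
form a subgroup. -/
def exitSubgroup (A : Finset G) (t : ℝ) (ht : 0 ≤ t)
    (h : ∀ x, ((A.exitSet x).card : ℝ) ≤ t → ((A.exitSet x).card : ℝ) ≤ t / 2) : Subgroup G where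
  carrier := {x | ((A.exitSet x).card : ℝ) ≤ t}
  one_mem' := by simpa [exitSet_one] using ht
  mul_mem' := by
    intro x y hx hy
    have h1 := h x hx
    have h2 := h y hy
    have h3 : ((A.exitSet (x * y)).card : ℝ) ≤ (A.exitSet x).card + (A.exitSet y).card := by
      exact_mod_cast card_exitSet_mul_le A x y
    change ((A.exitSet (x * y)).card : ℝ) ≤ t
    linarith
  inv_mem' := by
    intro x hx
    change ((A.exitSet x⁻¹).card : ℝ) ≤ t
    rw [card_exitSet_inv]
    exact hx

theorem card_inv_mul_self_le {A : Finset G} (hA : A.Nonempty) :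
    (A⁻¹ * A).card ≤ (A * A⁻¹ * A).card := by
  rw [mul_assoc]
  exact card_le_card_mul_left hA

theorem card_mul_inv_self_le {A : Finset G} (hA : A.Nonempty) :
    (A * A⁻¹).card ≤ (A * A⁻¹ * A).card :=
  card_le_card_mul_right hA

/-! ### Half graphs from many scales -/

/-- Averaging over translates. -/
theorem exists_mul_card_le {A W D : Finset G} {K : ℝ} (hK : ((A⁻¹ * A).card : ℝ) ≤ K)
    (hW : W ⊆ A) (hD : D ⊆ A) :
    ∃ g, (W.card : ℝ) * D.card ≤ (W.filter fun w => w * g ∈ D).card * K := by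
  by_contra! hcon
  have hmaps : ∀ p ∈ W ×ˢ D, p.1⁻¹ * p.2 ∈ A⁻¹ * A := fun p hp =>
    mul_mem_mul (inv_mem_inv (hW (mem_product.1 hp).1)) (hD (mem_product.1 hp).2)
  have hK0 : 0 ≤ K := le_trans (Nat.cast_nonneg _) hK
  have hpos : 0 < (W.card : ℝ) * D.card := lt_of_le_of_lt (by positivity) (hcon 1)
  have hne : (A⁻¹ * A).Nonempty := by
    have h1 : (W ×ˢ D).Nonempty := by
      rw [← card_pos, card_product]; exact_mod_cast hpos
    obtain ⟨p, hp⟩ := h1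
    exact ⟨_, hmaps p hp⟩
  have hcount : (W.card : ℝ) * D.card ≤
      ∑ g ∈ A⁻¹ * A, ((W.filter fun w => w * g ∈ D).card : ℝ) := by
    have h1 := card_eq_sum_card_fiberwise hmaps
    rw [card_product] at h1
    have h2 : W.card * D.card ≤ ∑ g ∈ A⁻¹ * A, (W.filter fun w => w * g ∈ D).card := by
      rw [h1]
      refine sum_le_sum fun g _ => ?_
      refine card_le_card_of_injOn Prod.fst ?_ ?_
      · intro p hp
        simp only [coe_filter, mem_product, Set.mem_ofPred_eq] at hp ⊢
        refine ⟨hp.1.1, ?_⟩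
        rw [← hp.2, mul_inv_cancel_left]
        exact hp.1.2
      · intro p hp q hq hpq
        simp only [coe_filter, mem_product, Set.mem_ofPred_eq] at hp hq
        refine Prod.ext hpq ?_
        have := hp.2.trans hq.2.symm
        rw [hpq] at this
        exact mul_left_cancel this
    exact_mod_cast h2
  have h3 : (∑ g ∈ A⁻¹ * A, ((W.filter fun w => w * g ∈ D).card : ℝ)) * K <
      (A⁻¹ * A).card * ((W.card : ℝ) * D.card) := by
    rw [sum_mul, ← nsmul_eq_mul, ← sum_const]
    exact sum_lt_sum_of_nonempty hne fun g _ => hcon g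
  nlinarith [mul_le_mul_of_nonneg_right hcount hK0, mul_le_mul_of_nonneg_right hK hpos.le]

/-- Scales decreasing so fast that translates of sets at successive scales form a half graph. -/
theorem exists_halfGraph_of_scales {A : Finset G} (hA : A.Nonempty) {c : ℝ} (hc : 1 ≤ c)
    (hK : ((A⁻¹ * A).card : ℝ) ≤ c * A.card) (κ : ℕ → ℝ) (hκ : ∀ i, 0 < κ i) (hκ1 : ∀ i, κ i ≤ 1)
    (hrec : ∀ i, κ (i + 1) = κ i ^ 2 / (8 * c)) (n : ℕ) :
    ∀ (i : ℕ) (W : Finset G) (D : ℕ → Finset G), W ⊆ A → κ i * A.card ≤ W.card →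
      (∀ a < n, D a ⊆ A ∧ κ (i + a) / 8 * A.card ≤ (D a).card ∧
        ((D a).card : ℝ) ≤ κ (i + a) / 4 * A.card) →
      (∑ a ∈ range n, ((D a).card : ℝ) ≤ κ i / 2 * A.card) ∧
      ∃ g z : ℕ → G, (∀ b < n, z b ∈ W) ∧ ∀ a < n, ∀ b < n, z b * g a ∈ D a ↔ a ≤ b := by
  have hA0 : (0 : ℝ) < A.card := by exact_mod_cast hA.card_pos
  induction n with
  | zero =>
    intro i W D _ _ _
    refine ⟨?_, fun _ => 1, fun _ => 1, by simp, by simp⟩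
    have := hκ i
    simp only [range_zero, sum_empty]
    positivity
  | succ n ih =>
    intro i W D hW hWc hD
    obtain ⟨hD0, hD1, hD2⟩ := hD 0 n.succ_pos
    simp only [add_zero] at hD1 hD2
    obtain ⟨g₀, hg₀⟩ := exists_mul_card_le hK hW hD0
    -- All later `z b` are chosen in `W'`, which fills the column of `g₀`.
    set W' := W.filter fun w => w * g₀ ∈ D 0 with hW'
    have hW'c : κ (i + 1) * A.card ≤ W'.card := by
      have h1 : (κ i * A.card) * (κ i / 8 * A.card) ≤ W'.card * (c * A.card) :=
        (mul_le_mul hWc hD1 (by have := hκ i; positivity) (by positivity)).trans hg₀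
      have h2 : κ i ^ 2 / 8 * A.card ≤ W'.card * c := by
        refine le_of_mul_le_mul_right ?_ hA0
        linarith
      rw [hrec, div_mul_eq_mul_div, div_le_iff₀ (by positivity)]
      linarith
    obtain ⟨hsum, g, z, hz, hzg⟩ := ih (i + 1) W' (fun a => D (a + 1))
      ((filter_subset _ _).trans hW) hW'c fun a ha => by
        have := hD (a + 1) (by omega)
        rwa [show i + (a + 1) = i + 1 + a by ring] at this
    have hdec : κ (i + 1) ≤ κ i / 8 := by
      rw [hrec, div_le_div_iff₀ (by positivity) (by norm_num)]
      nlinarith [hκ i, hκ1 i]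
    refine ⟨?_, ?_⟩
    · rw [sum_range_succ']
      nlinarith
    · obtain ⟨z₀, hz₀, hz₀'⟩ : ∃ z₀ ∈ W', ∀ a < n, z₀ * g a ∉ D (a + 1) := by
        by_contra! hcon
        have hsub : W' ⊆ (range n).biUnion fun a => (D (a + 1)).image (· * (g a)⁻¹) := by
          intro w hw
          obtain ⟨a, ha, hwa⟩ := hcon w hw
          exact mem_biUnion.2 ⟨a, mem_range.2 ha, mem_image.2 ⟨_, hwa, by simp⟩⟩
        have h1 : W'.card ≤ ∑ a ∈ range n, (D (a + 1)).card :=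
          (card_le_card hsub).trans (card_biUnion_le.trans (sum_le_sum fun a _ => card_image_le))
        have h2 : (W'.card : ℝ) ≤ ∑ a ∈ range n, ((D (a + 1)).card : ℝ) := by exact_mod_cast h1
        have := mul_pos (hκ (i + 1)) hA0
        linarith
      refine ⟨fun a => Nat.casesOn a g₀ g, fun b => Nat.casesOn b z₀ z, ?_, ?_⟩
      · rintro (_ | b) hb
        · exact (mem_filter.1 hz₀).1
        · exact (mem_filter.1 (hz b (by omega))).1
      · rintro (_ | a) ha (_ | b) hb
        · simpa using (mem_filter.1 hz₀).2
        · simpa using (mem_filter.1 (hz b (by omega))).2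
        · simpa using hz₀' a (by omega)
        · simpa using hzg a (by omega) b (by omega)

/-! ### Balanced splitting -/

/-- If few elements `x` have a small exit set, then every large subset of `A` is split in a balanced
way by a translate of `A`. -/
theorem exists_balanced_split {A P F : Finset G} {t K : ℝ} (ht : 0 ≤ t)
    (hK : ((A * A⁻¹).card : ℝ) ≤ K) (hK0 : 0 < K)
    (hP : ∀ x, ((A.exitSet x).card : ℝ) ≤ t → x ∈ P) (hF : F ⊆ A) (hFP : 2 * P.card ≤ F.card)
    (hF0 : F.Nonempty) :
    ∃ z, t / (2 * K) * F.card ≤ (F.filter fun b => z * b ∈ A).card ∧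
      t / (2 * K) * F.card ≤ (F.filter fun b => z * b ∉ A).card := by
  have hFpos : (0 : ℝ) < F.card := by exact_mod_cast hF0.card_pos
  have hAA : (A * A⁻¹).Nonempty := by
    obtain ⟨f, hf⟩ := hF0
    exact ⟨f * f⁻¹, mul_mem_mul (hF hf) (inv_mem_inv (hF hf))⟩
  have hrow : ∀ b ∈ F, (F.card : ℝ) / 2 * t ≤
      ∑ b' ∈ F, ((A.exitSet (b⁻¹ * b')).card : ℝ) := by
    intro b _
    -- At most half of the `b'` are close to `b`; each of the others contributes at least `t`.
    have h1 : (F.filter fun b' => b⁻¹ * b' ∈ P).card ≤ P.card := by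
      refine card_le_card_of_injOn (fun b' => b⁻¹ * b') ?_ ?_
      · intro b' hb'; exact (mem_filter.1 hb').2
      · intro x _ y _ hxy; exact mul_left_cancel hxy
    have h2 := card_filter_add_card_filter_not (s := F) (fun b' => b⁻¹ * b' ∈ P)
    have h3 : (F.card : ℝ) / 2 ≤ (F.filter fun b' => b⁻¹ * b' ∉ P).card := by
      rw [div_le_iff₀ (by norm_num)]
      have : F.card ≤ (F.filter fun b' => b⁻¹ * b' ∉ P).card * 2 := by omega
      exact_mod_cast this
    calc (F.card : ℝ) / 2 * t ≤ (F.filter fun b' => b⁻¹ * b' ∉ P).card * t := by gcongr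
      _ = (F.filter fun b' => b⁻¹ * b' ∉ P).card • t := by rw [nsmul_eq_mul]
      _ ≤ ∑ b' ∈ F.filter (fun b' => b⁻¹ * b' ∉ P), ((A.exitSet (b⁻¹ * b')).card : ℝ) := by
        refine card_nsmul_le_sum _ _ _ fun b' hb' => ?_
        by_contra! h
        exact (mem_filter.1 hb').2 (hP _ h.le)
      _ ≤ ∑ b' ∈ F, ((A.exitSet (b⁻¹ * b')).card : ℝ) :=
        sum_le_sum_of_subset_of_nonneg (filter_subset _ _) fun _ _ _ => by positivity
  -- Right translation by `b⁻¹` turns the exit set into the set of `z` separating `b` from `b'`.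
  -- Summing over pairs thus counts separations.
  have hexit : ∀ b ∈ F, ∀ b', (A.exitSet (b⁻¹ * b')).card =
      ((A * A⁻¹).filter fun z => z * b ∈ A ∧ z * b' ∉ A).card := by
    intro b hb b'
    refine card_bij' (fun a _ => a * b⁻¹) (fun z _ => z * b) ?_ ?_ ?_ ?_
    · intro a ha
      rw [mem_exitSet, ← mul_assoc] at ha
      exact mem_filter.2 ⟨mul_mem_mul ha.1 (inv_mem_inv (hF hb)), by simpa using ha.1, ha.2⟩
    · intro z hz
      rw [mem_filter] at hz
      exact mem_exitSet.2 ⟨hz.2.1, by simpa [mul_assoc] using hz.2.2⟩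
    · simp
    · simp
  have hdouble : ∑ b ∈ F, ∑ b' ∈ F, (A.exitSet (b⁻¹ * b')).card =
      ∑ z ∈ A * A⁻¹, (F.filter fun b => z * b ∈ A).card * (F.filter fun b => z * b ∉ A).card := by
    calc ∑ b ∈ F, ∑ b' ∈ F, (A.exitSet (b⁻¹ * b')).card
        = ∑ b ∈ F, ∑ b' ∈ F, ∑ z ∈ A * A⁻¹, if z * b ∈ A ∧ z * b' ∉ A then 1 else 0 :=
          sum_congr rfl fun b hb => sum_congr rfl fun b' _ => by
            rw [hexit b hb b', card_filter]
      _ = ∑ z ∈ A * A⁻¹, ∑ b ∈ F, ∑ b' ∈ F, if z * b ∈ A ∧ z * b' ∉ A then 1 else 0 := by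
          rw [sum_comm (s := A * A⁻¹)]
          exact sum_congr rfl fun b _ => sum_comm
      _ = _ := sum_congr rfl fun z _ => by
          rw [card_filter, card_filter, sum_mul_sum]
          exact sum_congr rfl fun b _ => sum_congr rfl fun b' _ => by
            by_cases h : z * b ∈ A <;> by_cases h' : z * b' ∈ A <;> simp [h, h']
  have htotal : (F.card : ℝ) * (F.card / 2 * t) ≤ ∑ z ∈ A * A⁻¹,
      ((F.filter fun b => z * b ∈ A).card : ℝ) * (F.filter fun b => z * b ∉ A).card := by
    have h1 : (∑ b ∈ F, ∑ b' ∈ F, ((A.exitSet (b⁻¹ * b')).card : ℝ)) = ∑ z ∈ A * A⁻¹,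
        ((F.filter fun b => z * b ∈ A).card : ℝ) * (F.filter fun b => z * b ∉ A).card := by
      exact_mod_cast hdouble
    rw [← h1, ← nsmul_eq_mul]
    exact card_nsmul_le_sum _ _ _ hrow
  obtain ⟨z, _, hz⟩ : ∃ z ∈ A * A⁻¹, (F.card : ℝ) * (F.card / 2 * t) / K ≤
      ((F.filter fun b => z * b ∈ A).card : ℝ) * (F.filter fun b => z * b ∉ A).card := by
    refine exists_le_of_sum_le hAA ?_
    rw [sum_const, nsmul_eq_mul]
    refine le_trans ?_ htotal
    rw [← mul_div_assoc, div_le_iff₀ hK0, mul_comm]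
    gcongr
  -- Both factors are at most `|F|`, so a product this large forces each of them to be at least `t /
  -- (2K) * |F|`.
  have hz' : t / (2 * K) * F.card * F.card ≤
      ((F.filter fun b => z * b ∈ A).card : ℝ) * (F.filter fun b => z * b ∉ A).card := by
    refine le_trans (le_of_eq ?_) hz
    field_simp
  have h1 : ((F.filter fun b => z * b ∈ A).card : ℝ) ≤ F.card := by
    exact_mod_cast card_filter_le _ _
  have h2 : ((F.filter fun b => z * b ∉ A).card : ℝ) ≤ F.card := by
    exact_mod_cast card_filter_le _ _
  refine ⟨z, ?_, ?_⟩
  · exact le_of_mul_le_mul_right (hz'.trans (by gcongr)) hFpos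
  · refine le_of_mul_le_mul_right (hz'.trans ?_) hFpos
    rw [mul_comm]
    gcongr

/-- Each balanced split keeps a fraction `t / (2K)` on both sides, so every set split along `d`
levels still has at least `2|P|` elements. -/
theorem hasSplitTree_of_card {A P : Finset G} {t K : ℝ} (ht : 0 ≤ t)
    (hK : ((A * A⁻¹).card : ℝ) ≤ K) (hK0 : 0 < K) (htK : t ≤ 2 * K)
    (hP : ∀ x, ((A.exitSet x).card : ℝ) ≤ t → x ∈ P) (hP0 : P.Nonempty) (d : ℕ) :
    ∀ F ⊆ A, 2 * (P.card : ℝ) ≤ (t / (2 * K)) ^ d * F.card →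
      HasSplitTree (fun z b => z * b ∈ A) d Set.univ (F : Set G) := by
  have hP' : (0 : ℝ) < P.card := by exact_mod_cast hP0.card_pos
  have hδ0 : 0 ≤ t / (2 * K) := by positivity
  have hδ1 : t / (2 * K) ≤ 1 := (div_le_one (by positivity)).2 htK
  have hcard : ∀ (d : ℕ) (F : Finset G), 2 * (P.card : ℝ) ≤ (t / (2 * K)) ^ d * F.card →
      2 * (P.card : ℝ) ≤ F.card := fun d F h =>
    h.trans (mul_le_of_le_one_left (by positivity) (pow_le_one₀ hδ0 hδ1))
  have hne : ∀ F : Finset G, 2 * (P.card : ℝ) ≤ F.card → F.Nonempty := fun F h => by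
    rw [← card_pos]
    have : (0 : ℝ) < F.card := by linarith
    exact_mod_cast this
  induction d with
  | zero => exact fun F _ h => hne F (hcard 0 F h)
  | succ d ih =>
    intro F hF h
    have h2 := hcard _ F h
    obtain ⟨z, hz1, hz2⟩ := exists_balanced_split ht hK hK0 hP hF (by exact_mod_cast h2) (hne F h2)
    have hpow : ∀ F' : Finset G, t / (2 * K) * F.card ≤ F'.card →
        2 * (P.card : ℝ) ≤ (t / (2 * K)) ^ d * F'.card := fun F' hF' => by
      refine h.trans ?_
      rw [pow_succ, mul_assoc]
      gcongr
    have t1 := ih _ ((filter_subset _ _).trans hF) (hpow _ hz1)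
    have t2 := ih _ ((filter_subset _ _).trans hF) (hpow _ hz2)
    rw [coe_filter] at t1 t2
    exact ⟨z, Set.mem_univ z, t1, t2⟩

end Finset

/-! ### Constants and conclusion -/

theorem IsStableSet.two_le {G : Type*} [Group G] {k : ℕ} {A : Set G} (hA : IsStableSet k A)
    (hne : A.Nonempty) : 2 ≤ k := by
  obtain ⟨a, ha⟩ := hne
  by_contra! h
  refine hA ⟨fun _ => a, fun _ => 1, fun i j => ?_⟩
  have : i ≤ j := by rw [Fin.le_def]; omega
  simpa [this] using ha

/-- With `m = 2 ^ (2k + 2)`, the left side is one factor from the tripling constant plus (inverse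
scale exponent, at most `2 ^ m`) times (tree depth `m`). -/
theorem exponent_bound {k : ℕ} (hk : 2 ≤ k) :
    1 + 2 ^ (2 ^ (2 * k + 2)) * 2 ^ (2 * k + 2) ≤ k ^ (2 ^ (2 ^ (2 * k))) := by
  have h1 : 2 ^ (2 * k + 2) < 2 ^ (2 ^ (2 * k + 2)) := Nat.lt_two_pow_self
  have h2 : 2 * k + 3 ≤ 2 ^ (2 * k) := by
    induction k, hk using Nat.le_induction with
    | base => norm_num
    | succ n _ ih =>
      have e : 2 ^ (2 * (n + 1)) = 4 * 2 ^ (2 * n) := by ring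
      have h := ih Nat.lt_two_pow_self
      omega
  generalize hm : 2 ^ (2 * k + 2) = m at *
  calc 1 + 2 ^ m * m ≤ 2 ^ m * (m + 1) := by nlinarith
    _ ≤ 2 ^ m * 2 ^ m := Nat.mul_le_mul_left _ h1
    _ = 2 ^ (2 ^ (2 * k + 3)) := by rw [← pow_add, ← two_mul, ← hm, ← pow_succ']
    _ ≤ 2 ^ (2 ^ (2 ^ (2 * k))) :=
      Nat.pow_le_pow_right two_pos (Nat.pow_le_pow_right two_pos h2)
    _ ≤ k ^ (2 ^ (2 ^ (2 * k))) := Nat.pow_le_pow_left hk _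

/-- A finite stable set of small tripling has a scale at which its approximate stabiliser is a
subgroup. -/
theorem IsStableSet.exists_scale {G : Type*} [Group G] [DecidableEq G] {k : ℕ} {A : Finset G}
    (hA : IsStableSet k (A : Set G)) (hne : A.Nonempty) {c : ℝ} (hc : 1 ≤ c)
    (hK : ((A⁻¹ * A).card : ℝ) ≤ c * A.card) {M : ℕ} (hM : 2 ^ (2 * k + 1) ≤ M) :
    ∃ i < M, ∀ x, ((A.exitSet x).card : ℝ) ≤ 8 * c / (8 * c) ^ (2 ^ i) / 4 * A.card →
      ((A.exitSet x).card : ℝ) ≤ 8 * c / (8 * c) ^ (2 ^ i) / 4 * A.card / 2 := by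
  by_contra! hcon
  choose! x hx1 hx2 using hcon
  have hB : 1 ≤ 8 * c := by linarith
  obtain ⟨-, g, z, -, h⟩ := Finset.exists_halfGraph_of_scales hne hc hK
    -- The solution of the recursion for `κ` with `κ 0 = 1`.
    (fun i => 8 * c / (8 * c) ^ (2 ^ i)) (fun i => by positivity)
    (fun i => (div_le_one (by positivity)).2 (le_self_pow₀ hB (by positivity)))
    (fun i => by
      rw [pow_succ 2 i, pow_mul]
      field_simp)
    M 0 A (fun i => A.exitSet (x i)) subset_rfl (by simp [div_self (by positivity : 8 * c ≠ 0)])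
    (fun a ha => ⟨A.exitSet_subset _, by rw [zero_add]; linarith [hx2 a ha], by
      rw [zero_add]; exact hx1 a ha⟩)
  refine hA.not_ladder_diff hM z g x fun i hi j hj => ?_
  have := h i hi j hj
  rwa [Finset.mem_exitSet] at this

theorem mainTheorem8 (k : ℕ) :
    ∃ C : ℝ, 0 < C ∧
      ∀ (G : Type*) [Group G] (A : Set G) (c : ℝ),
        A.Finite → A.Nonempty → IsStableSet k A →
        ((A * A⁻¹ * A).ncard : ℝ) ≤ c * (A.ncard : ℝ) →
        ∃ H : Subgroup G,
          (H : Set G) ⊆ A⁻¹ * A ∧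
          ∃ S : Finset G,
            (S.card : ℝ) ≤ C * c ^ (k ^ (2 ^ (2 ^ (2 * k)))) ∧
            A ⊆ ⋃ g ∈ S, g • (H : Set G) := by
  classical
  refine ⟨8 ^ (k ^ (2 ^ (2 ^ (2 * k)))), by positivity, ?_⟩
  intro G _ A c hfin hne hst htrip
  lift A to Finset G using hfin
  rw [← Finset.coe_inv, ← Finset.coe_mul, ← Finset.coe_mul, Set.ncard_coe_finset,
    Set.ncard_coe_finset] at htrip
  have hk := hst.two_le hne
  rw [Finset.coe_nonempty] at hne
  have hA0 : (0 : ℝ) < A.card := by exact_mod_cast hne.card_pos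
  have hleft : ((A⁻¹ * A).card : ℝ) ≤ c * A.card :=
    le_trans (by exact_mod_cast Finset.card_inv_mul_self_le hne) htrip
  have hright : ((A * A⁻¹).card : ℝ) ≤ c * A.card :=
    le_trans (by exact_mod_cast Finset.card_mul_inv_self_le hne) htrip
  have hc : 1 ≤ c := by
    have h1 : (A.card : ℝ) ≤ (A⁻¹ * A).card := by
      exact_mod_cast Finset.card_le_card_mul_left hne.inv
    exact le_of_mul_le_mul_right (by linarith) hA0
  have hB : 1 ≤ 8 * c := by linarith
  -- Half this `M` would do; the larger value agrees with the tree depth below, as in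
  -- `exponent_bound`.
  obtain ⟨i, hi, hscale⟩ := hst.exists_scale hne hc hleft
    (M := 2 ^ (2 * k + 2)) (Nat.pow_le_pow_right two_pos (by omega))
  set t : ℝ := 8 * c / (8 * c) ^ (2 ^ i) / 4 * A.card with ht
  have ht0 : 0 ≤ t := by positivity
  have hκ : 8 * c / (8 * c) ^ (2 ^ i) ≤ 1 :=
    (div_le_one (by positivity)).2 (le_self_pow₀ hB (by positivity))
  have htA : t < A.card := by rw [ht]; nlinarith
  set H := A.exitSubgroup t ht0 hscale
  have hHA : (H : Set G) ⊆ (A⁻¹ * A : Finset G) := by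
    intro x hx
    have hx' : ((A.exitSet x).card : ℝ) < A.card := lt_of_le_of_lt hx htA
    obtain ⟨a, ha, hax⟩ := Finset.exists_mem_notMem_of_card_lt_card (by exact_mod_cast hx')
    rw [Finset.mem_exitSet, not_and, not_not] at hax
    rw [Finset.mem_coe, ← inv_mul_cancel_left a x]
    exact Finset.mul_mem_mul (Finset.inv_mem_inv ha) (hax ha)
  obtain ⟨P, hP⟩ := ((A⁻¹ * A).finite_toSet.subset hHA).exists_finset_coe
  have hmemP : ∀ x, x ∈ P ↔ x ∈ H := fun x => by rw [← Finset.mem_coe, hP, SetLike.mem_coe]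
  have hP0 : P.Nonempty := ⟨1, (hmemP 1).2 H.one_mem⟩
  have hratio : t / (2 * (c * A.card)) = 1 / (8 * c) ^ (2 ^ i) := by
    rw [ht]; field_simp; norm_num
  -- Otherwise `A` itself would carry a split tree of depth `2 ^ (2k + 2)`, which stability forbids.
  have hlarge : (A.card : ℝ) ≤ 2 * P.card * (8 * c) ^ (2 ^ i * 2 ^ (2 * k + 2)) := by
    by_contra! hcon
    refine hst.not_hasSplitTree (D := 2 ^ (2 * k + 2)) (by omega) _ _
      (Finset.hasSplitTree_of_card ht0 hright (by positivity) (by nlinarith)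
        (fun x hx => (hmemP x).2 hx) hP0 (2 ^ (2 * k + 2)) A subset_rfl ?_)
    rw [hratio, one_div, inv_pow, ← pow_mul, inv_mul_eq_div, le_div_iff₀ (by positivity)]
    exact hcon.le
  have hAP : ((A * P).card : ℝ) ≤ c * A.card := by
    refine le_trans ?_ htrip
    rw [mul_assoc]
    have : P ⊆ A⁻¹ * A := by rw [← Finset.coe_subset, hP]; exact hHA
    exact_mod_cast Finset.card_le_card (Finset.mul_subset_mul_left this)
  -- Covering applies because `|AP| ≤ c|A|` and `hlarge` bounds `|A|` by a multiple of `|P|`. The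
  -- quotient set `P / P` it produces lies in `H`.
  obtain ⟨S, -, hS, hAS⟩ := Finset.ruzsa_covering_mul (A := A) hP0
    (K := 2 * c * (8 * c) ^ (2 ^ i * 2 ^ (2 * k + 2))) (by nlinarith)
  refine ⟨H, by simpa using hHA, S, hS.trans ?_, ?_⟩
  · rw [← mul_pow]
    calc 2 * c * (8 * c) ^ (2 ^ i * 2 ^ (2 * k + 2))
        ≤ (8 * c) * (8 * c) ^ (2 ^ i * 2 ^ (2 * k + 2)) := by gcongr; linarith
      _ = (8 * c) ^ (1 + 2 ^ i * 2 ^ (2 * k + 2)) := by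
        rw [pow_add (8 * c) 1, pow_one]
      _ ≤ (8 * c) ^ (k ^ (2 ^ (2 ^ (2 * k)))) := by
        refine pow_le_pow_right₀ hB (le_trans ?_ (exponent_bound hk))
        have := Nat.pow_le_pow_right two_pos hi.le
        gcongr
  · intro a ha
    obtain ⟨g, hg, y, hy, rfl⟩ := Finset.mem_mul.1 (hAS ha)
    obtain ⟨u, hu, v, hv, rfl⟩ := Finset.mem_div.1 hy
    exact Set.mem_biUnion hg ⟨_, H.div_mem ((hmemP u).1 hu) ((hmemP v).1 hv), rfl⟩
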